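/- Let $\mathcal H$ be the ring of Hurwitz integers, i.e. the subring of the real quaternions consisting of all $a+bi+cj+dk$ with $a,b,c,d$ all in $\mathbb Z$ or all in $\mathbb Z+\tfrac12$, with conjugation $x^\sigma=a-bi-cj-dk$, reduced norm $\mathrm N(x)=xx^\sigma=a^2+b^2+c^2+d^2$ and reduced trace $\mathrm{tr}(x)=x+x^\sigma=2a$. A Hurwitz prime is an irreducible element of $\mathcal H$. Let $p\neq q$ be rational primes and let $Q\in\mathcal H$ be a Hurwitz prime of norm $q$. Let $X_p$ be the set of Hurwitz primes of norm $p$ modulo left multiplication by units of $\mathcal H$. Then $X_p$ is finite, with $p+1$ elements if $p$ is odd and one element if $p=2$, and: 1. Metacommutation by $Q$ permutes $X_p$: there is a permutation $\tau_Q$ of $X_p$ such that, for all Hurwitz primes $P,P'$ of norm $p$, one has $\tau_Q([P])=[P']$ if and only if $PQ=Q'P'$ for some Hurwitz prime $Q'$ of norm $q$. 2. The sign of the permutation $\tau_Q$ is the quadratic character $\left(\frac{q}{p}\right)$ of $q$ modulo $p$ (which is $1$ when $p=2$). 3. If $p=2$, or if $Q$ is congruent to a rational integer modulo $p$ (i.e.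 $Q-n\in p\mathcal H$ for some $n\in\mathbb Z$), then $\tau_Q$ is the identity. Otherwise $\tau_Q$ has exactly $$1+\left(\frac{\mathrm{tr}(Q)^2-4q}{p}\right)$$ fixed points. -/

import Mathlib

/-- The Hurwitz integers: the real quaternions `a + bi + cj + dk` whose coordinates
`a, b, c, d` all lie in `ℤ` or all lie in `ℤ + 1/2`. -/
def hurwitzIntegers : Subring (Quaternion ℝ) where
  carrier := {x |
    (∃ a b c d : ℤ, x.re = a ∧ x.imI = b ∧ x.imJ = c ∧ x.imK = d) ∨
    (∃ a b c d : ℤ, x.re = a + 1 / 2 ∧ x.imI = b + 1 / 2 ∧ x.imJ = c + 1 / 2 ∧ x.imK = d + 1 / 2)}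
  zero_mem' := Or.inl ⟨0, 0, 0, 0, Quaternion.re_zero.trans (by simp),
    Quaternion.imI_zero.trans (by simp), Quaternion.imJ_zero.trans (by simp),
    Quaternion.imK_zero.trans (by simp)⟩
  one_mem' := Or.inl ⟨1, 0, 0, 0, Quaternion.re_one.trans (by simp),
    Quaternion.imI_one.trans (by simp), Quaternion.imJ_one.trans (by simp),
    Quaternion.imK_one.trans (by simp)⟩
  neg_mem' := by
    rintro x (⟨a, b, c, d, h1, h2, h3, h4⟩ | ⟨a, b, c, d, h1, h2, h3, h4⟩)
    · exact Or.inl ⟨-a, -b, -c, -d, by simp [h1, h2, h3, h4]⟩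
    · refine Or.inr ⟨-a - 1, -b - 1, -c - 1, -d - 1, ?_, ?_, ?_, ?_⟩ <;>
        simp only [Quaternion.re_neg, Quaternion.imI_neg, Quaternion.imJ_neg,
          Quaternion.imK_neg, h1, h2, h3, h4] <;> push_cast <;> ring
  add_mem' := by
    rintro x y (⟨a, b, c, d, h1, h2, h3, h4⟩ | ⟨a, b, c, d, h1, h2, h3, h4⟩)
      (⟨a', b', c', d', k1, k2, k3, k4⟩ | ⟨a', b', c', d', k1, k2, k3, k4⟩)
    · exact Or.inl ⟨a + a', b + b', c + c', d + d', by simp [h1, h2, h3, h4, k1, k2, k3, k4]⟩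
    · refine Or.inr ⟨a + a', b + b', c + c', d + d', ?_, ?_, ?_, ?_⟩ <;>
        simp only [Quaternion.re_add, Quaternion.imI_add, Quaternion.imJ_add,
          Quaternion.imK_add, h1, h2, h3, h4, k1, k2, k3, k4] <;> push_cast <;> ring
    · refine Or.inr ⟨a + a', b + b', c + c', d + d', ?_, ?_, ?_, ?_⟩ <;>
        simp only [Quaternion.re_add, Quaternion.imI_add, Quaternion.imJ_add,
          Quaternion.imK_add, h1, h2, h3, h4, k1, k2, k3, k4] <;> push_cast <;> ring
    · refine Or.inl ⟨a + a' + 1, b + b' + 1, c + c' + 1, d + d' + 1, ?_, ?_, ?_, ?_⟩ <;>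
        simp only [Quaternion.re_add, Quaternion.imI_add, Quaternion.imJ_add,
          Quaternion.imK_add, h1, h2, h3, h4, k1, k2, k3, k4] <;> push_cast <;> ring
  mul_mem' := by
    rintro x y (⟨a, b, c, d, h1, h2, h3, h4⟩ | ⟨a, b, c, d, h1, h2, h3, h4⟩)
      (⟨a', b', c', d', k1, k2, k3, k4⟩ | ⟨a', b', c', d', k1, k2, k3, k4⟩)
    · refine Or.inl ⟨a * a' - b * b' - c * c' - d * d', a * b' + b * a' + c * d' - d * c',
        a * c' - b * d' + c * a' + d * b', a * d' + b * c' - c * b' + d * a', ?_, ?_, ?_, ?_⟩ <;>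
        simp only [Quaternion.re_mul, Quaternion.imI_mul, Quaternion.imJ_mul,
          Quaternion.imK_mul, h1, h2, h3, h4, k1, k2, k3, k4] <;> push_cast <;> ring
    · obtain ⟨k, hk | hk⟩ := Int.even_or_odd' (a + b + c + d)
      · obtain rfl : a = 2 * k - b - c - d := by linarith
        refine Or.inl ⟨(2 * k - b - c - d) * a' - b * b' - c * c' - d * d' + k - b - c - d,
          (2 * k - b - c - d) * b' + b * a' + c * d' - d * c' + k - d,
          (2 * k - b - c - d) * c' - b * d' + c * a' + d * b' + k - b,
          (2 * k - b - c - d) * d' + b * c' - c * b' + d * a' + k - c, ?_, ?_, ?_, ?_⟩ <;>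
          simp only [Quaternion.re_mul, Quaternion.imI_mul, Quaternion.imJ_mul,
            Quaternion.imK_mul, h1, h2, h3, h4, k1, k2, k3, k4] <;> push_cast <;> ring
      · obtain rfl : a = 2 * k + 1 - b - c - d := by linarith
        refine Or.inr ⟨(2 * k + 1 - b - c - d) * a' - b * b' - c * c' - d * d' + k - b - c - d,
          (2 * k + 1 - b - c - d) * b' + b * a' + c * d' - d * c' + k - d,
          (2 * k + 1 - b - c - d) * c' - b * d' + c * a' + d * b' + k - b,
          (2 * k + 1 - b - c - d) * d' + b * c' - c * b' + d * a' + k - c, ?_, ?_, ?_, ?_⟩ <;>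
          simp only [Quaternion.re_mul, Quaternion.imI_mul, Quaternion.imJ_mul,
            Quaternion.imK_mul, h1, h2, h3, h4, k1, k2, k3, k4] <;> push_cast <;> ring
    · obtain ⟨k, hk | hk⟩ := Int.even_or_odd' (a' + b' + c' + d')
      · obtain rfl : a' = 2 * k - b' - c' - d' := by linarith
        refine Or.inl ⟨a * (2 * k - b' - c' - d') - b * b' - c * c' - d * d' + k - b' - c' - d',
          a * b' + b * (2 * k - b' - c' - d') + c * d' - d * c' + k - c',
          a * c' - b * d' + c * (2 * k - b' - c' - d') + d * b' + k - d',
          a * d' + b * c' - c * b' + d * (2 * k - b' - c' - d') + k - b', ?_, ?_, ?_, ?_⟩ <;>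
          simp only [Quaternion.re_mul, Quaternion.imI_mul, Quaternion.imJ_mul,
            Quaternion.imK_mul, h1, h2, h3, h4, k1, k2, k3, k4] <;> push_cast <;> ring
      · obtain rfl : a' = 2 * k + 1 - b' - c' - d' := by linarith
        refine Or.inr ⟨
          a * (2 * k + 1 - b' - c' - d') - b * b' - c * c' - d * d' + k - b' - c' - d',
          a * b' + b * (2 * k + 1 - b' - c' - d') + c * d' - d * c' + k - c',
          a * c' - b * d' + c * (2 * k + 1 - b' - c' - d') + d * b' + k - d',
          a * d' + b * c' - c * b' + d * (2 * k + 1 - b' - c' - d') + k - b', ?_, ?_, ?_, ?_⟩ <;>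
          simp only [Quaternion.re_mul, Quaternion.imI_mul, Quaternion.imJ_mul,
            Quaternion.imK_mul, h1, h2, h3, h4, k1, k2, k3, k4] <;> push_cast <;> ring
    · obtain ⟨k, hk | hk⟩ := Int.even_or_odd' (a + b + c + d + a' + b' + c' + d')
      · obtain rfl : a = 2 * k - b - c - d - a' - b' - c' - d' := by linarith
        refine Or.inr ⟨
          (2 * k - b - c - d - a' - b' - c' - d') * a' - b * b' - c * c' - d * d'
            + k - b - c - d - b' - c' - d' - 1,
          (2 * k - b - c - d - a' - b' - c' - d') * b' + b * a' + c * d' - d * c' + k - d - c',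
          (2 * k - b - c - d - a' - b' - c' - d') * c' - b * d' + c * a' + d * b' + k - b - d',
          (2 * k - b - c - d - a' - b' - c' - d') * d' + b * c' - c * b' + d * a' + k - c - b',
          ?_, ?_, ?_, ?_⟩ <;>
          simp only [Quaternion.re_mul, Quaternion.imI_mul, Quaternion.imJ_mul,
            Quaternion.imK_mul, h1, h2, h3, h4, k1, k2, k3, k4] <;> push_cast <;> ring
      · obtain rfl : a = 2 * k + 1 - b - c - d - a' - b' - c' - d' := by linarith
        refine Or.inl ⟨
          (2 * k + 1 - b - c - d - a' - b' - c' - d') * a' - b * b' - c * c' - d * d'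
            + k - b - c - d - b' - c' - d',
          (2 * k + 1 - b - c - d - a' - b' - c' - d') * b' + b * a' + c * d' - d * c'
            + k - d - c' + 1,
          (2 * k + 1 - b - c - d - a' - b' - c' - d') * c' - b * d' + c * a' + d * b'
            + k - b - d' + 1,
          (2 * k + 1 - b - c - d - a' - b' - c' - d') * d' + b * c' - c * b' + d * a'
            + k - c - b' + 1,
          ?_, ?_, ?_, ?_⟩ <;>
          simp only [Quaternion.re_mul, Quaternion.imI_mul, Quaternion.imJ_mul,
            Quaternion.imK_mul, h1, h2, h3, h4, k1, k2, k3, k4] <;> push_cast <;> ring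

/-- The reduced trace `tr x = x + x^σ = 2 a` of a Hurwitz integer `x = a + bi + cj + dk`,
as an integer (see `hurwitzTrace_spec`; the floor only serves to land in `ℤ`). -/
noncomputable def hurwitzTrace (x : hurwitzIntegers) : ℤ := ⌊2 * (x : Quaternion ℝ).re⌋

theorem hurwitzTrace_spec (x : hurwitzIntegers) :
    ((hurwitzTrace x : ℤ) : Quaternion ℝ) = (x : Quaternion ℝ) + star (x : Quaternion ℝ) := by
  have h : ((hurwitzTrace x : ℤ) : ℝ) = 2 * (x : Quaternion ℝ).re := by
    obtain ⟨y, ⟨a, b, c, d, h1, -⟩ | ⟨a, b, c, d, h1, -⟩⟩ := x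
    · have : (2 * y.re : ℝ) = ((2 * a : ℤ) : ℝ) := by rw [h1]; push_cast; ring
      simp only [hurwitzTrace, this, Int.floor_intCast]
    · have : (2 * y.re : ℝ) = ((2 * a + 1 : ℤ) : ℝ) := by rw [h1]; push_cast; ring
      simp only [hurwitzTrace, this, Int.floor_intCast]
  have e := congrArg (fun r : ℝ => (r : Quaternion ℝ)) h
  exact ((Quaternion.coe_intCast _).symm.trans e).trans
    (Quaternion.self_add_star' (x : Quaternion ℝ)).symm

/-- Hurwitz primes (irreducible elements of the ring of Hurwitz integers) of reduced norm `p`. -/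
def HurwitzPrime (p : ℕ) : Type :=
  {P : hurwitzIntegers // Irreducible P ∧ Quaternion.normSq (P : Quaternion ℝ) = (p : ℝ)}

/-- The Hurwitz integer underlying a Hurwitz prime. -/
def HurwitzPrime.val {p : ℕ} (P : HurwitzPrime p) : hurwitzIntegers := Subtype.val P

/-- Two Hurwitz primes of norm `p` are equivalent if they differ by left multiplication by a
unit of the ring of Hurwitz integers. -/
instance leftAssociated (p : ℕ) : Setoid (HurwitzPrime p) where
  r P P' := ∃ u : hurwitzIntegersˣ, (u : hurwitzIntegers) * P.val = P'.val
  iseqv :=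
    { refl := fun _ => ⟨1, by simp⟩
      symm := by
        rintro P P' ⟨u, hu⟩
        exact ⟨u⁻¹, by rw [← hu, Units.inv_mul_cancel_left]⟩
      trans := by
        rintro P P' P'' ⟨u, hu⟩ ⟨v, hv⟩
        exact ⟨v * u, by rw [← hv, ← hu, Units.val_mul, mul_assoc]⟩ }

/-- The Hurwitz primes of norm `p` modulo left multiplication by units. -/
def HurwitzPrimeClass (p : ℕ) : Type := Quotient (leftAssociated p)

/-- The class of a Hurwitz prime modulo left multiplication by units. -/
def HurwitzPrime.toClass {p : ℕ} (P : HurwitzPrime p) : HurwitzPrimeClass p :=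
  Quotient.mk (leftAssociated p) P

/-- Metacommutation: `P'` arises from `P` by metacommutation with `Q` if `P Q = Q' P'` for some
Hurwitz prime `Q'` of the same norm as `Q`. -/
def Metacommutes {p q : ℕ} (Q : HurwitzPrime q) (P P' : HurwitzPrime p) : Prop :=
  ∃ Q' : HurwitzPrime q, P.val * Q.val = Q'.val * P'.val

/-- `x` is congruent to a rational integer modulo `p`, that is, `x - n` lies in the two-sided
ideal generated by `p` in the Hurwitz integers for some integer `n`. -/
def CongruentToInt (p : ℕ) (x : hurwitzIntegers) : Prop :=
  ∃ (n : ℤ) (y : hurwitzIntegers), x - (n : hurwitzIntegers) = (p : hurwitzIntegers) * y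

/-! For odd `p`, a solution of `s² + t² = -1` in `𝔽_p` gives a surjection `φ : ℋ → M₂(𝔽_p)` with
kernel `pℋ`, taking reduced norm and trace to determinant and trace. If `P` has norm `p`, then
`φ(P)` is nonzero and singular, so its kernel is a line, and `x ∈ ℋP` exactly when `φ(x)` kills that
line. Left ideals of `ℋ` are principal, so every line arises: `X_p` is the projective line over
`𝔽_p` (`classEquiv`).

The relation `PQ = Q'P'` says `PQ ∈ ℋP'`, that is, `φ(Q)` carries the line of `P'` to the line of
`P` (`metacommutes_iff_kernelPoint`). So `τ_Q` is the action of `φ(Q)⁻¹`, and two facts about `g ∈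
GL₂(𝔽_p)` finish the proof: its sign on the projective line is the quadratic character of `det g`,
and a nonscalar `g` has `1 + χ(tr² - 4 det)` fixed points. Scalar `φ(Q)` means `Q` congruent to an
integer.

For `p = 2`, the elements of even norm form the left ideal `ℋ(1+i)`, so there is a single class. -/

/-! ### Möbius action on the projective line: signs and fixed points -/

section ProjectiveLine

open Matrix OnePoint

variable {F : Type*} [Field F] [DecidableEq F]

/-- The matrix `diag(u, 1)` as an element of `GL₂`. -/
def diagOne (u : Fˣ) : GL (Fin 2) F :=
  GeneralLinearGroup.mkOfDetNeZero !![(u : F), 0; 0, 1] (by simp [det_fin_two])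

theorem diagOne_smul_coe (u : Fˣ) (x : F) : diagOne u • (x : OnePoint F) = ((u * x : F) : OnePoint F) := by
  simp [smul_some_eq_ite, diagOne, GeneralLinearGroup.mkOfDetNeZero]

theorem diagOne_smul_infty (u : Fˣ) : diagOne u • (∞ : OnePoint F) = ∞ := by
  simp [smul_infty_eq_self_iff, diagOne, GeneralLinearGroup.mkOfDetNeZero]

theorem toPerm_diagOne_zpow (u : Fˣ) (n : ℤ) :
    (MulAction.toPerm (diagOne u) : Equiv.Perm (OnePoint F)) ^ n
      = MulAction.toPerm (diagOne (u ^ n)) := by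
  have h (a b : Fˣ) : (MulAction.toPerm (diagOne (a * b)) : Equiv.Perm (OnePoint F))
      = MulAction.toPerm (diagOne a) * MulAction.toPerm (diagOne b) := by
    ext x
    induction x using OnePoint.rec with
    | infty => simp [diagOne_smul_infty]
    | coe x => simp [diagOne_smul_coe, mul_assoc]
  let f : Fˣ →* Equiv.Perm (OnePoint F) :=
    MonoidHom.mk' (fun u => MulAction.toPerm (diagOne u)) h
  exact (map_zpow f u n).symm

variable [Fintype F]

/-- `x ↦ ux` fixes `0` and `∞` and is a single cycle on `Fˣ`. The cycle length `|F| - 1` is even, so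
the cycle is odd. -/
theorem sign_diagOne_generator [Fintype (OnePoint F)] [DecidableEq (OnePoint F)]
    (hF : ringChar F ≠ 2) (u : Fˣ) (hu : ∀ x : Fˣ, x ∈ Subgroup.zpowers u) :
    Equiv.Perm.sign (MulAction.toPerm (diagOne u) : Equiv.Perm (OnePoint F)) = -1 := by
  have h2 : (2 : F) ≠ 0 := Ring.two_ne_zero hF
  -- If the generator were `1`, then `-1 = 1`, against odd characteristic.
  have hu1 : (u : F) ≠ 1 := by
    intro h
    have h' : u = 1 := Units.ext h
    obtain ⟨n, hn⟩ := hu (-1)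
    rw [h'] at hn
    simp only [_root_.one_zpow] at hn
    have := congrArg (Units.val) hn
    simp only [Units.val_one, Units.val_neg] at this
    exact h2 (by linear_combination this)
  have hmove (x : OnePoint F) : diagOne u • x ≠ x ↔ x ≠ ∞ ∧ x ≠ ((0 : F) : OnePoint F) := by
    induction x using OnePoint.rec with
    | infty => simp [diagOne_smul_infty]
    | coe x => simp [diagOne_smul_coe, mul_left_eq_self₀, hu1]
  have hcyc : (MulAction.toPerm (diagOne u) : Equiv.Perm (OnePoint F)).IsCycle := by
    refine ⟨((1 : F) : OnePoint F), ?_, ?_⟩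
    · rw [MulAction.toPerm_apply, hmove]; simp
    · intro y hy
      rw [MulAction.toPerm_apply, hmove] at hy
      induction y using OnePoint.rec with
      | infty => exact absurd rfl hy.1
      | coe y =>
        have hy0 : y ≠ 0 := fun h => hy.2 (by rw [h])
        obtain ⟨n, hn⟩ := hu (Units.mk0 y hy0)
        refine ⟨n, ?_⟩
        simp only at hn
        rw [toPerm_diagOne_zpow, hn, MulAction.toPerm_apply, diagOne_smul_coe]
        simp
  have hsupp : (MulAction.toPerm (diagOne u) : Equiv.Perm (OnePoint F)).support
      = {∞, ((0 : F) : OnePoint F)}ᶜ := by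
    ext x
    rw [Equiv.Perm.mem_support, MulAction.toPerm_apply, hmove]
    simp
  have hcard : Fintype.card (OnePoint F) = Fintype.card F + 1 := by
    rw [← Fintype.card_option]; exact Fintype.card_congr (Equiv.refl _)
  rw [hcyc.sign, hsupp, Finset.card_compl, Finset.card_pair (infty_ne_coe _), hcard]
  obtain ⟨k, hk⟩ := Nat.odd_iff.2 (FiniteField.odd_card_of_char_ne_two hF)
  rw [hk, show 2 * k + 1 + 1 - 2 = 2 * k by omega]
  simp

/-- Both sides are homomorphisms from the cyclic group `Fˣ` to `±1`, and both are `-1` on a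
generator. -/
theorem sign_diagOne [Fintype (OnePoint F)] [DecidableEq (OnePoint F)]
    (hF : ringChar F ≠ 2) (a : Fˣ) :
    ((Equiv.Perm.sign (MulAction.toPerm (diagOne a) : Equiv.Perm (OnePoint F)) : ℤˣ) : ℤ)
      = quadraticChar F a := by
  obtain ⟨u, hu⟩ := IsCyclic.exists_generator (α := Fˣ)
  let χ : Fˣ →* ℤˣ := (quadraticChar F).toUnitHom
  have hχ (x : Fˣ) : ((χ x : ℤˣ) : ℤ) = quadraticChar F x := MulChar.coe_toUnitHom _ _
  have hχu : χ u = -1 := by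
    obtain ⟨b, hb⟩ := quadraticChar_exists_neg_one' hF
    refine (Int.units_eq_one_or _).resolve_left fun h => ?_
    obtain ⟨n, hn⟩ := hu b
    simp only at hn
    rw [← hχ, ← hn, map_zpow, h, _root_.one_zpow] at hb
    norm_num at hb
  obtain ⟨n, hn⟩ := hu a
  simp only at hn
  rw [← hχ, ← hn, map_zpow, hχu, ← toPerm_diagOne_zpow, map_zpow, sign_diagOne_generator hF u hu]

/-- Both sides are multiplicative, so diagonal matrices and transvections suffice. `diag(a, d)` acts
as `diag(a/d, 1)`, and the determinants differ by the square `d²`. A transvection is the square of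
another one, since `2` is invertible, hence is even. -/
theorem sign_toPerm_generalLinearGroup [Fintype (OnePoint F)] [DecidableEq (OnePoint F)]
    (hF : ringChar F ≠ 2) (g : GL (Fin 2) F) :
    ((Equiv.Perm.sign (MulAction.toPerm g : Equiv.Perm (OnePoint F)) : ℤˣ) : ℤ)
      = quadraticChar F g.val.det := by
  have h2 : (2 : F) ≠ 0 := Ring.two_ne_zero hF
  have hmulPerm (a b : GL (Fin 2) F) : (MulAction.toPerm (a * b) : Equiv.Perm (OnePoint F))
      = MulAction.toPerm a * MulAction.toPerm b := map_mul (MulAction.toPermHom _ _) a b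
  suffices H : ∀ h : GL (Fin 2) F, h.val = g.val →
      ((Equiv.Perm.sign (MulAction.toPerm h : Equiv.Perm (OnePoint F)) : ℤˣ) : ℤ)
        = quadraticChar F g.val.det from H g rfl
  refine diagonal_transvection_induction_of_det_ne_zero
    (fun M => ∀ h : GL (Fin 2) F, h.val = M →
      ((Equiv.Perm.sign (MulAction.toPerm h : Equiv.Perm (OnePoint F)) : ℤˣ) : ℤ)
        = quadraticChar F M.det) g.val g.det_ne_zero ?_ ?_ ?_
  · intro D hD h hh
    rw [det_diagonal, Fin.prod_univ_two] at *
    have h0 : D 0 ≠ 0 := left_ne_zero_of_mul hD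
    have h1 : D 1 ≠ 0 := right_ne_zero_of_mul hD
    have e : (MulAction.toPerm h : Equiv.Perm (OnePoint F))
        = MulAction.toPerm (diagOne (Units.mk0 (D 0 / D 1) (div_ne_zero h0 h1))) := by
      ext x
      rw [MulAction.toPerm_apply, MulAction.toPerm_apply]
      induction x using OnePoint.rec with
      | infty => rw [diagOne_smul_infty, smul_infty_eq_self_iff, hh]; simp
      | coe x =>
        rw [diagOne_smul_coe, smul_some_eq_ite, hh]
        simp [h1, div_mul_eq_mul_div]
    rw [e, sign_diagOne hF, Units.val_mk0,
      show D 0 * D 1 = D 0 / D 1 * D 1 ^ 2 by field_simp, map_mul, quadraticChar_sq_one' h1,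
      mul_one]
  · intro t h hh
    have : NeZero (2 : F) := ⟨h2⟩
    obtain ⟨i, j, hij, c⟩ := t
    let r : GL (Fin 2) F := GeneralLinearGroup.mkOfDetNeZero (transvection i j (c / 2))
      (by rw [det_transvection_of_ne _ _ hij]; exact one_ne_zero)
    have e : h = r * r := by
      apply Units.ext
      rw [hh]
      change transvection i j c = transvection i j (c / 2) * transvection i j (c / 2)
      rw [transvection_mul_transvection_same _ _ hij, add_halves]
    rw [e, hmulPerm, map_mul, Int.units_mul_self, TransvectionStruct.det]
    simp
  · intro A B hA hB IA IB h hh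
    have e : h = GeneralLinearGroup.mkOfDetNeZero A hA * GeneralLinearGroup.mkOfDetNeZero B hB :=
      Units.ext hh
    rw [e, hmulPerm, map_mul, Units.val_mul, IA _ rfl, IB _ rfl, det_mul, map_mul]

/-- For `g` with rows `(a, b)`, `(c, d)`, a finite fixed point is a root of `cx² + (d-a)x - b`,
whose discriminant is `tr² - 4 det`; `∞` is fixed exactly when `c = 0`. -/
theorem ncard_fixedPoints_generalLinearGroup (hF : ringChar F ≠ 2) (g : GL (Fin 2) F)
    (hg : ∀ c : F, g.val ≠ scalar (Fin 2) c) :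
    (Set.ncard {x : OnePoint F | g • x = x} : ℤ)
      = 1 + quadraticChar F (g.val.trace ^ 2 - 4 * g.val.det) := by
  have h2 : (2 : F) ≠ 0 := Ring.two_ne_zero hF
  have hdet := g.det_ne_zero
  rw [det_fin_two] at hdet
  have hcoe (x : F) : g • (x : OnePoint F) = x ↔
      g 1 0 * x ^ 2 + (g 1 1 - g 0 0) * x - g 0 1 = 0 := by
    rw [← GeneralLinearGroup.fixpointPolynomial_aeval_eq_zero_iff,
      GeneralLinearGroup.fixpointPolynomial]
    simp
  rw [trace_fin_two, det_fin_two]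
  by_cases hc : g 1 0 = 0
  · have hinf : g • (∞ : OnePoint F) = ∞ := smul_infty_eq_self_iff.2 hc
    by_cases had : g 0 0 = g 1 1
    · have hb : g 0 1 ≠ 0 := by
        intro hb
        refine hg (g 0 0) ?_
        ext i j
        fin_cases i <;> fin_cases j <;> simp [hb, hc, had]
      have : {x : OnePoint F | g • x = x} = {∞} := by
        ext x
        induction x using OnePoint.rec with
        | infty => simp [hinf]
        | coe x => simp [hcoe, hc, had, hb]
      rw [this, Set.ncard_singleton, hc, had,
        show (g 1 1 + g 1 1) ^ 2 - 4 * (g 1 1 * g 1 1 - g 0 1 * 0) = 0 by ring]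
      simp
    · have hda : g 1 1 - g 0 0 ≠ 0 := sub_ne_zero.2 (Ne.symm had)
      have : {x : OnePoint F | g • x = x} = {∞, ((g 0 1 / (g 1 1 - g 0 0) : F) : OnePoint F)} := by
        ext x
        induction x using OnePoint.rec with
        | infty => simp [hinf]
        | coe x => simp [hcoe, hc, eq_div_iff hda, sub_eq_zero, mul_comm]
      rw [this, Set.ncard_pair (infty_ne_coe _), hc,
        show (g 0 0 + g 1 1) ^ 2 - 4 * (g 0 0 * g 1 1 - g 0 1 * 0) = (g 1 1 - g 0 0) ^ 2 by ring,
        quadraticChar_sq_one' hda]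
      norm_num
  -- Completing the square: `y = 2cx + (d-a)` matches roots `x` with square roots `y` of the
  -- discriminant.
  · let f : F → OnePoint F := fun y => ((y - (g 1 1 - g 0 0)) / (2 * g 1 0) : F)
    have hf : Function.Injective f := by
      intro y z h
      have := OnePoint.coe_injective h
      rw [div_left_inj' (mul_ne_zero h2 hc)] at this
      exact sub_left_injective this
    have : {x : OnePoint F | g • x = x}
        = f '' {y | y ^ 2 = (g 0 0 + g 1 1) ^ 2 - 4 * (g 0 0 * g 1 1 - g 0 1 * g 1 0)} := by
      ext x
      induction x using OnePoint.rec with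
      | infty =>
        simp only [Set.mem_ofPred_eq, smul_infty_eq_self_iff, hc, Set.mem_image, false_iff]
        rintro ⟨y, -, hy⟩
        exact coe_ne_infty _ hy
      | coe x =>
        rw [Set.mem_ofPred_eq, hcoe, Set.mem_image]
        constructor
        · intro h
          refine ⟨2 * g 1 0 * x + (g 1 1 - g 0 0), ?_, ?_⟩
          · rw [Set.mem_ofPred_eq]; linear_combination 4 * g 1 0 * h
          · simp only [f, add_sub_cancel_right]
            rw [mul_div_cancel_left₀ _ (mul_ne_zero h2 hc)]
        · rintro ⟨y, hy, hyx⟩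
          have hyx := OnePoint.coe_injective hyx
          rw [div_eq_iff (mul_ne_zero h2 hc)] at hyx
          rw [Set.mem_ofPred_eq, show y = 2 * g 1 0 * x + (g 1 1 - g 0 0) by
            linear_combination hyx] at hy
          have : 4 * g 1 0 * (g 1 0 * x ^ 2 + (g 1 1 - g 0 0) * x - g 0 1) = 0 := by
            linear_combination hy
          refine (mul_eq_zero.1 this).resolve_left (mul_ne_zero ?_ hc)
          rw [show (4 : F) = 2 * 2 by norm_num]
          exact mul_ne_zero h2 h2
    rw [this, Set.ncard_image_of_injective _ hf, Set.ncard_eq_toFinset_card',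
      quadraticChar_card_sqrts hF]
    ring

end ProjectiveLine

/-! ### Coordinates, norm and Euclidean division in the Hurwitz integers -/

namespace HurwitzInt

/-- Twice the real part of a Hurwitz integer. -/
noncomputable def dRe (x : hurwitzIntegers) : ℤ := ⌊2 * (x : Quaternion ℝ).re⌋

/-- Twice the `i`-coordinate of a Hurwitz integer. -/
noncomputable def dI (x : hurwitzIntegers) : ℤ := ⌊2 * (x : Quaternion ℝ).imI⌋

/-- Twice the `j`-coordinate of a Hurwitz integer. -/
noncomputable def dJ (x : hurwitzIntegers) : ℤ := ⌊2 * (x : Quaternion ℝ).imJ⌋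

/-- Twice the `k`-coordinate of a Hurwitz integer. -/
noncomputable def dK (x : hurwitzIntegers) : ℤ := ⌊2 * (x : Quaternion ℝ).imK⌋

/-- Doubling makes both kinds of Hurwitz integer quadruples of integers of equal parity, so that
computations can take place in `ℤ`. -/
theorem exists_coords (x : hurwitzIntegers) : ∃ a b c d : ℤ,
    (2 * (x : Quaternion ℝ).re = a ∧ 2 * (x : Quaternion ℝ).imI = b ∧
      2 * (x : Quaternion ℝ).imJ = c ∧ 2 * (x : Quaternion ℝ).imK = d) ∧
    a % 2 = b % 2 ∧ a % 2 = c % 2 ∧ a % 2 = d % 2 := by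
  obtain ⟨y, ⟨a, b, c, d, h1, h2, h3, h4⟩ | ⟨a, b, c, d, h1, h2, h3, h4⟩⟩ := x
  · refine ⟨2 * a, 2 * b, 2 * c, 2 * d, ?_, by omega⟩
    simp only [h1, h2, h3, h4]
    push_cast
    exact ⟨rfl, rfl, rfl, rfl⟩
  · refine ⟨2 * a + 1, 2 * b + 1, 2 * c + 1, 2 * d + 1, ?_, by omega⟩
    simp only [h1, h2, h3, h4]
    push_cast
    refine ⟨?_, ?_, ?_, ?_⟩ <;> ring

theorem coords_spec (x : hurwitzIntegers) :
    (2 * (x : Quaternion ℝ).re = dRe x ∧ 2 * (x : Quaternion ℝ).imI = dI x ∧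
      2 * (x : Quaternion ℝ).imJ = dJ x ∧ 2 * (x : Quaternion ℝ).imK = dK x) ∧
    dRe x % 2 = dI x % 2 ∧ dRe x % 2 = dJ x % 2 ∧ dRe x % 2 = dK x % 2 := by
  obtain ⟨a, b, c, d, ⟨h1, h2, h3, h4⟩, h⟩ := exists_coords x
  simp only [dRe, dI, dJ, dK, h1, h2, h3, h4, Int.floor_intCast]
  exact ⟨⟨trivial, trivial, trivial, trivial⟩, h⟩

theorem cast_dRe (x : hurwitzIntegers) : (dRe x : ℝ) = 2 * (x : Quaternion ℝ).re :=
  (coords_spec x).1.1.symm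

theorem cast_dI (x : hurwitzIntegers) : (dI x : ℝ) = 2 * (x : Quaternion ℝ).imI :=
  (coords_spec x).1.2.1.symm

theorem cast_dJ (x : hurwitzIntegers) : (dJ x : ℝ) = 2 * (x : Quaternion ℝ).imJ :=
  (coords_spec x).1.2.2.1.symm

theorem cast_dK (x : hurwitzIntegers) : (dK x : ℝ) = 2 * (x : Quaternion ℝ).imK :=
  (coords_spec x).1.2.2.2.symm

theorem parity (x : hurwitzIntegers) :
    dRe x % 2 = dI x % 2 ∧ dRe x % 2 = dJ x % 2 ∧ dRe x % 2 = dK x % 2 :=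
  (coords_spec x).2

theorem ext_coords {x y : hurwitzIntegers} (h0 : dRe x = dRe y) (h1 : dI x = dI y)
    (h2 : dJ x = dJ y) (h3 : dK x = dK y) : x = y := by
  have e0 := cast_dRe x
  have e1 := cast_dI x
  have e2 := cast_dJ x
  have e3 := cast_dK x
  rw [h0, cast_dRe] at e0
  rw [h1, cast_dI] at e1
  rw [h2, cast_dJ] at e2
  rw [h3, cast_dK] at e3
  apply Subtype.ext
  ext <;> linarith

/-- Four integers of equal parity are the doubled coordinates of a Hurwitz integer. -/
theorem exists_of_coords (a b c d : ℤ) (hb : a % 2 = b % 2) (hc : a % 2 = c % 2)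
    (hd : a % 2 = d % 2) :
    ∃ x : hurwitzIntegers, dRe x = a ∧ dI x = b ∧ dJ x = c ∧ dK x = d := by
  have hmem : (⟨a / 2, b / 2, c / 2, d / 2⟩ : Quaternion ℝ) ∈ hurwitzIntegers := by
    obtain ⟨k, hk | hk⟩ := Int.even_or_odd' a
    · obtain ⟨l, hl⟩ : ∃ l, b = 2 * l := ⟨b / 2, by omega⟩
      obtain ⟨m, hm⟩ : ∃ m, c = 2 * m := ⟨c / 2, by omega⟩
      obtain ⟨n, hn⟩ : ∃ n, d = 2 * n := ⟨d / 2, by omega⟩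
      refine Or.inl ⟨k, l, m, n, ?_⟩
      simp only [hk, hl, hm, hn]
      push_cast
      refine ⟨?_, ?_, ?_, ?_⟩ <;> ring
    · obtain ⟨l, hl⟩ : ∃ l, b = 2 * l + 1 := ⟨b / 2, by omega⟩
      obtain ⟨m, hm⟩ : ∃ m, c = 2 * m + 1 := ⟨c / 2, by omega⟩
      obtain ⟨n, hn⟩ : ∃ n, d = 2 * n + 1 := ⟨d / 2, by omega⟩
      refine Or.inr ⟨k, l, m, n, ?_⟩
      simp only [hk, hl, hm, hn]
      push_cast
      refine ⟨?_, ?_, ?_, ?_⟩ <;> ring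
  refine ⟨⟨_, hmem⟩, ?_, ?_, ?_, ?_⟩
  · simp [dRe, mul_div_cancel₀]
  · simp [dI, mul_div_cancel₀]
  · simp [dJ, mul_div_cancel₀]
  · simp [dK, mul_div_cancel₀]

theorem coords_add (x y : hurwitzIntegers) :
    dRe (x + y) = dRe x + dRe y ∧ dI (x + y) = dI x + dI y ∧
      dJ (x + y) = dJ x + dJ y ∧ dK (x + y) = dK x + dK y := by
  refine ⟨?_, ?_, ?_, ?_⟩ <;> rify <;>
    simp only [cast_dRe, cast_dI, cast_dJ, cast_dK, Subring.coe_add, Quaternion.re_add,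
      Quaternion.imI_add, Quaternion.imJ_add, Quaternion.imK_add] <;> ring

theorem coords_mul (x y : hurwitzIntegers) :
    2 * dRe (x * y) = dRe x * dRe y - dI x * dI y - dJ x * dJ y - dK x * dK y ∧
    2 * dI (x * y) = dRe x * dI y + dI x * dRe y + dJ x * dK y - dK x * dJ y ∧
    2 * dJ (x * y) = dRe x * dJ y - dI x * dK y + dJ x * dRe y + dK x * dI y ∧
    2 * dK (x * y) = dRe x * dK y + dI x * dJ y - dJ x * dI y + dK x * dRe y := by
  refine ⟨?_, ?_, ?_, ?_⟩ <;> rify <;>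
    simp only [cast_dRe, cast_dI, cast_dJ, cast_dK, Subring.coe_mul, Quaternion.re_mul,
      Quaternion.imI_mul, Quaternion.imJ_mul, Quaternion.imK_mul] <;> ring

theorem coords_intCast (n : ℤ) :
    dRe (n : hurwitzIntegers) = 2 * n ∧ dI (n : hurwitzIntegers) = 0 ∧
      dJ (n : hurwitzIntegers) = 0 ∧ dK (n : hurwitzIntegers) = 0 := by
  refine ⟨?_, ?_, ?_, ?_⟩ <;> rify <;>
    simp [cast_dRe, cast_dI, cast_dJ, cast_dK]

/-- The reduced norm as a natural number. -/
noncomputable def nrm (x : hurwitzIntegers) : ℕ := ⌊Quaternion.normSq (x : Quaternion ℝ)⌋₊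

theorem cast_nrm (x : hurwitzIntegers) :
    (nrm x : ℝ) = Quaternion.normSq (x : Quaternion ℝ) := by
  suffices h : ∃ n : ℤ, (n : ℝ) = Quaternion.normSq (x : Quaternion ℝ) by
    obtain ⟨n, hn⟩ := h
    have hn0 : 0 ≤ n := by
      have := Quaternion.normSq_nonneg (a := (x : Quaternion ℝ))
      rw [← hn] at this
      exact_mod_cast this
    lift n to ℕ using hn0
    rw [nrm, ← hn]
    simp
  obtain ⟨y, ⟨a, b, c, d, h1, h2, h3, h4⟩ | ⟨a, b, c, d, h1, h2, h3, h4⟩⟩ := x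
  · refine ⟨a ^ 2 + b ^ 2 + c ^ 2 + d ^ 2, ?_⟩
    simp [Quaternion.normSq_def', h1, h2, h3, h4]
  · refine ⟨a ^ 2 + b ^ 2 + c ^ 2 + d ^ 2 + a + b + c + d + 1, ?_⟩
    simp only [Quaternion.normSq_def', h1, h2, h3, h4]
    push_cast
    ring

theorem four_mul_nrm (x : hurwitzIntegers) :
    4 * (nrm x : ℤ) = dRe x ^ 2 + dI x ^ 2 + dJ x ^ 2 + dK x ^ 2 := by
  rify
  rw [cast_nrm, cast_dRe, cast_dI, cast_dJ, cast_dK, Quaternion.normSq_def']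
  ring

theorem nrm_mul (x y : hurwitzIntegers) : nrm (x * y) = nrm x * nrm y := by
  rify
  simp only [cast_nrm, Subring.coe_mul, map_mul]

theorem nrm_one : nrm 1 = 1 := by
  rify
  simp [cast_nrm]

theorem nrm_natCast (n : ℕ) : nrm (n : hurwitzIntegers) = n ^ 2 := by
  rify
  rw [cast_nrm, Subring.coe_natCast, Quaternion.normSq_natCast]

theorem nrm_eq_zero {x : hurwitzIntegers} : nrm x = 0 ↔ x = 0 := by
  rify
  rw [cast_nrm, Quaternion.normSq_eq_zero, ZeroMemClass.coe_eq_zero]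

theorem exists_conj (x : hurwitzIntegers) :
    ∃ y : hurwitzIntegers, (y : Quaternion ℝ) = star (x : Quaternion ℝ) := by
  obtain ⟨y, h0, h1, h2, h3⟩ := exists_of_coords (dRe x) (-dI x) (-dJ x) (-dK x)
    (by have := parity x; omega) (by have := parity x; omega) (by have := parity x; omega)
  refine ⟨y, ?_⟩
  have e0 := cast_dRe y
  have e1 := cast_dI y
  have e2 := cast_dJ y
  have e3 := cast_dK y
  rw [h0, cast_dRe] at e0
  rw [h1, Int.cast_neg, cast_dI] at e1
  rw [h2, Int.cast_neg, cast_dJ] at e2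
  rw [h3, Int.cast_neg, cast_dK] at e3
  ext <;> simp <;> linarith

/-- Conjugation on Hurwitz integers. -/
noncomputable def conj (x : hurwitzIntegers) : hurwitzIntegers := (exists_conj x).choose

theorem coe_conj (x : hurwitzIntegers) : (conj x : Quaternion ℝ) = star (x : Quaternion ℝ) :=
  (exists_conj x).choose_spec

theorem mul_conj (x : hurwitzIntegers) : x * conj x = (nrm x : hurwitzIntegers) := by
  apply Subtype.ext
  rw [Subring.coe_mul, coe_conj, Quaternion.self_mul_star, ← cast_nrm, Subring.coe_natCast,
    Quaternion.coe_natCast]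

theorem conj_mul (x : hurwitzIntegers) : conj x * x = (nrm x : hurwitzIntegers) := by
  apply Subtype.ext
  rw [Subring.coe_mul, coe_conj, Quaternion.star_mul_self, ← cast_nrm, Subring.coe_natCast,
    Quaternion.coe_natCast]

theorem coords_conj (x : hurwitzIntegers) :
    dRe (conj x) = dRe x ∧ dI (conj x) = -dI x ∧ dJ (conj x) = -dJ x ∧ dK (conj x) = -dK x := by
  refine ⟨?_, ?_, ?_, ?_⟩ <;> rify <;> simp [cast_dRe, cast_dI, cast_dJ, cast_dK, coe_conj]

/-- A Hurwitz integer of norm one as a unit. -/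
noncomputable def unitOfNrm (x : hurwitzIntegers) (hx : nrm x = 1) : hurwitzIntegersˣ where
  val := x
  inv := conj x
  val_inv := by rw [mul_conj, hx, Nat.cast_one]
  inv_val := by rw [conj_mul, hx, Nat.cast_one]

theorem isUnit_iff_nrm {x : hurwitzIntegers} : IsUnit x ↔ nrm x = 1 := by
  refine ⟨?_, fun h => ⟨unitOfNrm x h, rfl⟩⟩
  rintro ⟨u, rfl⟩
  have := nrm_mul u ↑u⁻¹
  rw [Units.mul_inv, nrm_one] at this
  exact Nat.eq_one_of_mul_eq_one_right this.symm

theorem irreducible_of_nrm_prime {x : hurwitzIntegers} {q : ℕ} (hq : q.Prime) (hx : nrm x = q) :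
    Irreducible x := by
  refine ⟨fun h => hq.one_lt.ne' (hx ▸ isUnit_iff_nrm.1 h), fun a b hab => ?_⟩
  have h : nrm a * nrm b = q := by rw [← nrm_mul, ← hab, hx]
  rw [isUnit_iff_nrm, isUnit_iff_nrm]
  rcases (Nat.dvd_prime hq).1 (Dvd.intro _ h) with ha | ha
  · exact Or.inl ha
  · refine Or.inr (Nat.eq_of_mul_eq_mul_left hq.pos ?_)
    rw [mul_one, ← ha, h, ha]

/-- Rounding each coordinate gives an error of at most `4 · 1/4 = 1`. Equality forces all
coordinates to be half-odd, and then `t` itself is a Hurwitz integer. -/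
theorem exists_normSq_sub_lt_one (t : Quaternion ℝ) :
    ∃ z : hurwitzIntegers, Quaternion.normSq (t - (z : Quaternion ℝ)) < 1 := by
  have hbound (r : ℝ) : (r - round r) ^ 2 ≤ 1 / 4 := by
    have := sq_le_sq' (neg_le_of_abs_le (abs_sub_round r)) (le_of_abs_le (abs_sub_round r))
    linarith
  let z : hurwitzIntegers := ⟨⟨round t.re, round t.imI, round t.imJ, round t.imK⟩,
    Or.inl ⟨_, _, _, _, rfl, rfl, rfl, rfl⟩⟩
  by_cases hlt : Quaternion.normSq (t - (z : Quaternion ℝ)) < 1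
  · exact ⟨z, hlt⟩
  · have e : Quaternion.normSq (t - (z : Quaternion ℝ)) = (t.re - round t.re) ^ 2 + (t.imI - round t.imI) ^ 2 +
        (t.imJ - round t.imJ) ^ 2 + (t.imK - round t.imK) ^ 2 := by
      rw [Quaternion.normSq_def']
      rfl
    rw [e] at hlt
    have hhalf (r : ℝ) (hr : (r - round r) ^ 2 = 1 / 4) : ∃ n : ℤ, r = n + 1 / 2 := by
      have : (r - round r - 1 / 2) * (r - round r + 1 / 2) = 0 := by linear_combination hr
      rcases mul_eq_zero.1 this with h | h
      · exact ⟨round r, by linarith⟩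
      · exact ⟨round r - 1, by push_cast; linarith⟩
    have b0 := hbound t.re
    have b1 := hbound t.imI
    have b2 := hbound t.imJ
    have b3 := hbound t.imK
    obtain ⟨a, ha⟩ := hhalf t.re (by linarith)
    obtain ⟨b, hb⟩ := hhalf t.imI (by linarith)
    obtain ⟨c, hc⟩ := hhalf t.imJ (by linarith)
    obtain ⟨d, hd⟩ := hhalf t.imK (by linarith)
    exact ⟨⟨t, Or.inr ⟨a, b, c, d, ha, hb, hc, hd⟩⟩, by simp⟩

theorem exists_nrm_sub_mul_lt (x : hurwitzIntegers) {y : hurwitzIntegers} (hy : y ≠ 0) :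
    ∃ z, nrm (x - z * y) < nrm y := by
  have hy' : (y : Quaternion ℝ) ≠ 0 := by simpa using hy
  obtain ⟨z, hz⟩ := exists_normSq_sub_lt_one ((x : Quaternion ℝ) * (y : Quaternion ℝ)⁻¹)
  refine ⟨z, ?_⟩
  rify
  rw [cast_nrm, cast_nrm, AddSubgroupClass.coe_sub, Subring.coe_mul,
    show (x : Quaternion ℝ) - z * y = (x * (y : Quaternion ℝ)⁻¹ - z) * y by
      rw [sub_mul, inv_mul_cancel_right₀ hy'], map_mul]
  have : 0 < Quaternion.normSq (y : Quaternion ℝ) :=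
    lt_of_le_of_ne Quaternion.normSq_nonneg (Ne.symm (Quaternion.normSq_ne_zero.2 hy'))
  exact mul_lt_of_lt_one_left this hz

/-- Left ideals of the Hurwitz integers are principal. -/
theorem exists_generator (I : Ideal hurwitzIntegers) :
    ∃ d ∈ I, ∀ x ∈ I, ∃ b, x = b * d := by
  by_cases hI : ∃ x ∈ I, x ≠ 0
  · obtain ⟨d, ⟨hd, hd0⟩, hmin⟩ := (measure nrm).wf.has_min {x | x ∈ I ∧ x ≠ 0} hI
    refine ⟨d, hd, fun x hx => ?_⟩
    obtain ⟨z, hz⟩ := exists_nrm_sub_mul_lt x hd0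
    refine ⟨z, ?_⟩
    -- A nonzero remainder would lie in `I` with norm below the minimal one.
    by_contra hne
    exact hmin (x - z * d) ⟨I.sub_mem hx (I.mul_mem_left z hd), sub_ne_zero.2 hne⟩ hz
  · push Not at hI
    exact ⟨0, I.zero_mem, fun x hx => ⟨0, by rw [hI x hx, mul_zero]⟩⟩

/-- Since `y * conj y` is the central integer `nrm y`, right divisibility by `y` becomes a
congruence modulo `nrm y`, which can be tested after reduction. -/
theorem exists_eq_mul_iff {x y : hurwitzIntegers} (hy : y ≠ 0) :
    (∃ z, x = z * y) ↔ ∃ z, x * conj y = (nrm y : hurwitzIntegers) * z := by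
  constructor
  · rintro ⟨z, rfl⟩
    exact ⟨z, by rw [mul_assoc, mul_conj, (Nat.cast_commute _ _).eq]⟩
  · rintro ⟨z, hz⟩
    refine ⟨z, ?_⟩
    have hn : (nrm y : hurwitzIntegers) ≠ 0 := by
      rw [Ne, ← nrm_eq_zero, nrm_natCast]
      exact pow_ne_zero 2 (mt nrm_eq_zero.1 hy)
    refine mul_left_cancel₀ hn ?_
    rw [← mul_assoc, ← hz, mul_assoc, conj_mul, (Nat.cast_commute _ _).eq]

end HurwitzInt

/-! ### Reduction of the Hurwitz integers to `2 × 2` matrices -/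

namespace HurwitzInt

open Matrix

section Reduction

variable {K : Type*} [Field K]

/-- The splitting of the Hurwitz integers over a field of odd characteristic given by a solution
of `s² + t² = -1`. -/
noncomputable def toMatrix (s t : K) (h2 : (2 : K) ≠ 0) (hst : s ^ 2 + t ^ 2 = -1) :
    hurwitzIntegers →+* Matrix (Fin 2) (Fin 2) K where
  -- Here `i ↦ (0, -1; 1, 0)`, `j ↦ (s, t; t, -s)`, and `k` goes to their product `(-t, s; s, t)`.
  -- The halves undo the doubling of coordinates.
  toFun x := !![(dRe x + dJ x * s - dK x * t) / 2, (-dI x + dJ x * t + dK x * s) / 2;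
    (dI x + dJ x * t + dK x * s) / 2, (dRe x - dJ x * s + dK x * t) / 2]
  map_one' := by
    have h := coords_intCast 1
    rw [Int.cast_one] at h
    rw [h.1, h.2.1, h.2.2.1, h.2.2.2, one_fin_two]
    simp [h2]
  map_zero' := by
    have h := coords_intCast 0
    rw [Int.cast_zero] at h
    rw [h.1, h.2.1, h.2.2.1, h.2.2.2]
    ext i j
    fin_cases i <;> fin_cases j <;> simp
  map_add' x y := by
    obtain ⟨h0, h1, h2, h3⟩ := coords_add x y
    rw [h0, h1, h2, h3]
    ext i j
    fin_cases i <;> fin_cases j <;> simp <;> ring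
  map_mul' x y := by
    obtain ⟨h0, h1, h2', h3⟩ := coords_mul x y
    replace h0 := congrArg (Int.cast : ℤ → K) h0
    replace h1 := congrArg (Int.cast : ℤ → K) h1
    replace h2' := congrArg (Int.cast : ℤ → K) h2'
    replace h3 := congrArg (Int.cast : ℤ → K) h3
    push_cast at h0 h1 h2' h3
    ext i j
    fin_cases i <;> fin_cases j <;>
      simp only [Fin.zero_eta, Fin.mk_one, of_apply, cons_val', cons_val_zero, cons_val_one,
        cons_val_fin_one, mul_apply, Fin.sum_univ_two] <;> field_simp
    · linear_combination h0 + s * h2' - t * h3 -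
        ((dJ x : K) * dJ y + dK x * dK y) * hst
    · linear_combination -h1 + t * h2' + s * h3 -
        ((dJ x : K) * dK y - dK x * dJ y) * hst
    · linear_combination h1 + t * h2' + s * h3 -
        ((dK x : K) * dJ y - dJ x * dK y) * hst
    · linear_combination h0 - s * h2' + t * h3 -
        ((dJ x : K) * dJ y + dK x * dK y) * hst

variable {s t : K} (h2 : (2 : K) ≠ 0) (hst : s ^ 2 + t ^ 2 = -1)

theorem toMatrix_apply (x : hurwitzIntegers) : toMatrix s t h2 hst x =
    !![(dRe x + dJ x * s - dK x * t) / 2, (-dI x + dJ x * t + dK x * s) / 2;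
      (dI x + dJ x * t + dK x * s) / 2, (dRe x - dJ x * s + dK x * t) / 2] := rfl

theorem det_toMatrix (x : hurwitzIntegers) : (toMatrix s t h2 hst x).det = (nrm x : K) := by
  have h := congrArg (Int.cast : ℤ → K) (four_mul_nrm x)
  push_cast at h
  rw [toMatrix_apply, det_fin_two_of]
  have h4 : (4 : K) ≠ 0 := by
    rw [show (4 : K) = 2 * 2 by norm_num]; exact mul_ne_zero h2 h2
  refine mul_left_cancel₀ h4 ?_
  rw [h]
  field_simp
  linear_combination -4 * ((dJ x : K) ^ 2 + dK x ^ 2) * hst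

theorem trace_toMatrix (x : hurwitzIntegers) : (toMatrix s t h2 hst x).trace = (dRe x : K) := by
  rw [toMatrix_apply, trace_fin_two_of]
  field_simp
  ring

theorem toMatrix_conj (x : hurwitzIntegers) :
    toMatrix s t h2 hst (conj x) = (toMatrix s t h2 hst x).adjugate := by
  obtain ⟨e0, e1, e2, e3⟩ := coords_conj x
  rw [toMatrix_apply, toMatrix_apply, adjugate_fin_two_of, e0, e1, e2, e3]
  ext i j
  fin_cases i <;> fin_cases j <;> simp <;> ring

theorem toMatrix_intCast (n : ℤ) : toMatrix s t h2 hst n = scalar (Fin 2) (n : K) := by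
  rw [map_intCast, map_intCast]

end Reduction

section ZMod

variable {p : ℕ} [Fact p.Prime] {s t : ZMod p} (h2 : (2 : ZMod p) ≠ 0) (hst : s ^ 2 + t ^ 2 = -1)

/-- The images of `1, i, j, k` are linearly independent, so a vanishing matrix forces `p` to divide
every doubled coordinate. -/
theorem toMatrix_eq_zero_iff (x : hurwitzIntegers) :
    toMatrix s t h2 hst x = 0 ↔ ∃ y, x = (p : hurwitzIntegers) * y := by
  constructor
  · intro h
    have e00 : (dRe x + dJ x * s - dK x * t) / 2 = 0 := congrFun (congrFun h 0) 0
    have e01 : (-dI x + dJ x * t + dK x * s) / 2 = 0 := congrFun (congrFun h 0) 1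
    have e10 : (dI x + dJ x * t + dK x * s) / 2 = 0 := congrFun (congrFun h 1) 0
    have e11 : (dRe x - dJ x * s + dK x * t) / 2 = 0 := congrFun (congrFun h 1) 1
    field_simp at e00 e01 e10 e11
    have f0 : (dRe x : ZMod p) = 0 := mul_left_cancel₀ h2 (by linear_combination e00 + e11)
    have f1 : (dI x : ZMod p) = 0 := mul_left_cancel₀ h2 (by linear_combination e10 - e01)
    have g2 : (dJ x : ZMod p) * s - dK x * t = 0 := by linear_combination e00 - f0
    have g3 : (dJ x : ZMod p) * t + dK x * s = 0 := by linear_combination e10 - f1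
    -- The system `g2`, `g3` in `dJ x`, `dK x` has determinant `s² + t² = -1`.
    have f2 : (dJ x : ZMod p) = 0 := by linear_combination -s * g2 - t * g3 + (dJ x : ZMod p) * hst
    have f3 : (dK x : ZMod p) = 0 := by linear_combination t * g2 - s * g3 + (dK x : ZMod p) * hst
    rw [ZMod.intCast_zmod_eq_zero_iff_dvd] at f0 f1 f2 f3
    obtain ⟨a, ha⟩ := f0
    obtain ⟨b, hb⟩ := f1
    obtain ⟨c, hc⟩ := f2
    obtain ⟨d, hd⟩ := f3
    -- As `p` is odd, dividing by `p` preserves the parities, so the quotients are again doubled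
    -- coordinates.
    have hp : (p : ℤ) % 2 = 1 := by
      have hp2 : p ≠ 2 := by
        rintro rfl
        exact h2 (mod_cast CharP.cast_eq_zero (ZMod 2) 2)
      have := (Fact.out : p.Prime).eq_two_or_odd
      omega
    have hpar (m : ℤ) : ((p : ℤ) * m) % 2 = m % 2 := by
      rw [Int.mul_emod, hp, one_mul, Int.emod_emod]
    obtain ⟨k1, k2, k3⟩ := parity x
    rw [ha, hb, hpar, hpar] at k1
    rw [ha, hc, hpar, hpar] at k2
    rw [ha, hd, hpar, hpar] at k3
    obtain ⟨y, y0, y1, y2, y3⟩ := exists_of_coords a b c d k1 k2 k3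
    have hn := coords_intCast p
    rw [Int.cast_natCast] at hn
    obtain ⟨n0, n1, n2, n3⟩ := hn
    obtain ⟨m0, m1, m2, m3⟩ := coords_mul (p : hurwitzIntegers) y
    rw [n0, n1, n2, n3, y0, y1, y2, y3] at m0 m1 m2 m3
    exact ⟨y, ext_coords (by linarith) (by linarith) (by linarith) (by linarith)⟩
  · rintro ⟨y, rfl⟩
    rw [map_mul, map_natCast, CharP.cast_eq_zero (Matrix (Fin 2) (Fin 2) (ZMod p)) p, zero_mul]

theorem toMatrix_surjective : Function.Surjective (toMatrix s t h2 hst) := by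
  intro M
  -- Even lifts make the parity condition automatic; the arguments of `lift` below solve the linear
  -- system for the coordinates of `M` in the images of `1, i, j, k`.
  let lift (z : ZMod p) : ℤ := 2 * (z.val : ℤ)
  have hlift (z : ZMod p) : ((lift z : ℤ) : ZMod p) = 2 * z := by simp [lift]
  have hpar (z w : ZMod p) : lift z % 2 = lift w % 2 := by simp [lift]
  obtain ⟨x, h0, h1, h3, h4⟩ := exists_of_coords (lift ((M 0 0 + M 1 1) / 2))
    (lift ((M 1 0 - M 0 1) / 2))
    (lift (-((M 0 0 - M 1 1) / 2 * s + (M 0 1 + M 1 0) / 2 * t)))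
    (lift ((M 0 0 - M 1 1) / 2 * t - (M 0 1 + M 1 0) / 2 * s)) (hpar _ _) (hpar _ _) (hpar _ _)
  refine ⟨x, ?_⟩
  rw [toMatrix_apply, h0, h1, h3, h4, hlift, hlift, hlift, hlift]
  ext i j
  fin_cases i <;> fin_cases j <;>
    simp only [Fin.zero_eta, Fin.mk_one, of_apply, cons_val', cons_val_zero, cons_val_one,
      cons_val_fin_one] <;> field_simp
  · linear_combination -(M 0 0 - M 1 1) * hst
  · linear_combination -(M 0 1 + M 1 0) * hst
  · linear_combination -(M 0 1 + M 1 0) * hst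
  · linear_combination (M 0 0 - M 1 1) * hst

end ZMod

end HurwitzInt

/-! ### Kernels of singular `2 × 2` matrices -/

section FinTwo

open Matrix

variable {K : Type*} [Field K]

/-- If `v` and `w` were independent, Cramer's rule would make every row of `A` vanish. -/
theorem Matrix.exists_smul_eq_of_mulVec_eq_zero {A : Matrix (Fin 2) (Fin 2) K} (hA : A ≠ 0)
    {v w : Fin 2 → K} (hv0 : v ≠ 0) (hv : A *ᵥ v = 0) (hw : A *ᵥ w = 0) : ∃ c : K, w = c • v := by
  have hdet : v 0 * w 1 = v 1 * w 0 := by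
    by_contra hne
    apply hA
    have hv' (i) : A i 0 * v 0 + A i 1 * v 1 = 0 := by
      simpa [mulVec, dotProduct, Fin.sum_univ_two] using congrFun hv i
    have hw' (i) : A i 0 * w 0 + A i 1 * w 1 = 0 := by
      simpa [mulVec, dotProduct, Fin.sum_univ_two] using congrFun hw i
    have hne' : v 0 * w 1 - v 1 * w 0 ≠ 0 := sub_ne_zero.2 hne
    ext i j
    have h0 : A i 0 = 0 := (mul_eq_zero.1 (show A i 0 * (v 0 * w 1 - v 1 * w 0) = 0 by
      linear_combination w 1 * hv' i - v 1 * hw' i)).resolve_right hne'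
    have h1 : A i 1 = 0 := (mul_eq_zero.1 (show A i 1 * (v 0 * w 1 - v 1 * w 0) = 0 by
      linear_combination v 0 * hw' i - w 0 * hv' i)).resolve_right hne'
    fin_cases j
    · exact h0
    · exact h1
  by_cases h0 : v 0 = 0
  · have h1 : v 1 ≠ 0 := fun h1 => hv0 (by ext i; fin_cases i <;> assumption)
    refine ⟨w 1 / v 1, ?_⟩
    ext i
    fin_cases i
    · have : w 0 = 0 := by simpa [h0, h1] using hdet.symm
      simp [h0, this]
    · simp [h1]
  · refine ⟨w 0 / v 0, ?_⟩
    ext i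
    fin_cases i
    · simp [h0]
    · simp only [Fin.mk_one, Pi.smul_apply, smul_eq_mul]
      field_simp
      linear_combination hdet

/-- As `A * adj A = 0`, the columns of `adj A` lie on the line `ker A`, and they are not all zero
because `A ≠ 0`. -/
theorem Matrix.mul_adjugate_eq_zero_iff_mulVec {A : Matrix (Fin 2) (Fin 2) K} (hA : A ≠ 0)
    (hdet : A.det = 0) {v : Fin 2 → K} (hv0 : v ≠ 0) (hv : A *ᵥ v = 0)
    (B : Matrix (Fin 2) (Fin 2) K) : B * A.adjugate = 0 ↔ B *ᵥ v = 0 := by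
  have hcol (j) : ∃ c : K, A.adjugate.col j = c • v := by
    refine exists_smul_eq_of_mulVec_eq_zero hA hv0 hv ?_
    have := congrFun (congrArg col (mul_adjugate A)) j
    rw [hdet, zero_smul] at this
    exact this
  choose c hc using hcol
  have hBcol (j) : (B * A.adjugate).col j = c j • B *ᵥ v := by
    rw [← mulVec_smul, ← hc]
    rfl
  constructor
  · intro h
    obtain ⟨j, hj⟩ : ∃ j, c j ≠ 0 := by
      by_contra! hall
      apply hA
      have hz : A.adjugate = 0 := by
        ext i j
        have := congrFun (hc j) i
        rwa [hall j, zero_smul] at this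
      rw [adjugate_fin_two] at hz
      have h00 := congrFun (congrFun hz 0) 0
      have h01 := congrFun (congrFun hz 0) 1
      have h10 := congrFun (congrFun hz 1) 0
      have h11 := congrFun (congrFun hz 1) 1
      ext i j
      fin_cases i <;> fin_cases j <;> simp_all
    have := hBcol j
    rw [h] at this
    exact (smul_eq_zero.1 this.symm).resolve_left hj
  · intro h
    ext i j
    have := congrFun (hBcol j) i
    rwa [h, smul_zero] at this

end FinTwo

/-! ### Classes of Hurwitz primes and metacommutation as left divisibility conditions -/

namespace HurwitzInt

open Matrix

theorem nrm_val {p : ℕ} (P : HurwitzPrime p) : nrm P.val = p := by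
  rify
  rw [cast_nrm]
  exact P.2.2

theorem exists_hurwitzPrime_val_eq {p : ℕ} (hp : p.Prime) {x : hurwitzIntegers} (hx : nrm x = p) :
    ∃ P : HurwitzPrime p, P.val = x :=
  ⟨⟨x, irreducible_of_nrm_prime hp hx, by rw [← cast_nrm, hx]⟩, rfl⟩

/-- Comparing norms shows that the cofactor `z` has norm one, so it is a unit. -/
theorem toClass_eq_iff {p : ℕ} (hp : p.Prime) (P P' : HurwitzPrime p) :
    P.toClass = P'.toClass ↔ ∃ z, P.val = z * P'.val := by
  refine eq_comm.trans (Quotient.eq (r := leftAssociated p) (x := P') (y := P) |>.trans ?_)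
  constructor
  · rintro ⟨u, hu⟩
    exact ⟨u, hu.symm⟩
  · rintro ⟨z, hz⟩
    have h := nrm_mul z P'.val
    rw [← hz, nrm_val, nrm_val] at h
    exact ⟨unitOfNrm z (Nat.eq_of_mul_eq_mul_right hp.pos (by rw [← h, one_mul])), hz.symm⟩

/-- The cofactor has norm `q` by multiplicativity, so it is automatically a Hurwitz prime. -/
theorem metacommutes_iff {p q : ℕ} (hp : p.Prime) (hq : q.Prime) (Q : HurwitzPrime q)
    (P P' : HurwitzPrime p) : Metacommutes Q P P' ↔ ∃ z, P.val * Q.val = z * P'.val := by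
  constructor
  · rintro ⟨Q', h⟩
    exact ⟨Q'.val, h⟩
  · rintro ⟨z, hz⟩
    have h := nrm_mul z P'.val
    rw [← hz, nrm_mul, nrm_val, nrm_val, nrm_val, mul_comm] at h
    obtain ⟨Q', rfl⟩ := exists_hurwitzPrime_val_eq hq (Nat.eq_of_mul_eq_mul_right hp.pos h.symm)
    exact ⟨Q', hz⟩

theorem val_ne_zero {p : ℕ} (hp : p.Prime) (P : HurwitzPrime p) : P.val ≠ 0 := by
  rw [Ne, ← nrm_eq_zero, nrm_val]
  exact hp.ne_zero

/-! ### The prime 2 -/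

section Two

/-- Four odd squares sum to `4` modulo `8`, so half-odd coordinates give odd norm. Even norm thus
means integer coordinates with even sum, which makes `x(1-i)` divisible by `2`. -/
theorem exists_one_add_i : ∃ θ : hurwitzIntegers,
    nrm θ = 2 ∧ ∀ x, 2 ∣ nrm x → ∃ y, x = y * θ := by
  obtain ⟨θ, t0, t1, t2, t3⟩ := exists_of_coords 2 2 0 0 rfl rfl rfl
  have hθ : nrm θ = 2 := by
    have h := four_mul_nrm θ
    rw [t0, t1, t2, t3] at h
    omega
  have hθ0 : θ ≠ 0 := by rw [Ne, ← nrm_eq_zero, hθ]; norm_num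
  refine ⟨θ, hθ, fun x ⟨m, hm⟩ => (exists_eq_mul_iff hθ0).2 ?_⟩
  have hN := four_mul_nrm x
  obtain ⟨p1, p2, p3⟩ := parity x
  obtain ⟨m0, m1, m2, m3⟩ := coords_mul x (conj θ)
  obtain ⟨c0, c1, c2, c3⟩ := coords_conj θ
  rw [c0, c1, c2, c3, t0, t1, t2, t3] at m0 m1 m2 m3
  rw [hm] at hN
  push_cast at hN
  have hodd (k : ℤ) (hk : k % 2 = 1) : k ^ 2 % 8 = 1 := by
    rcases (by omega : k % 8 = 1 ∨ k % 8 = 3 ∨ k % 8 = 5 ∨ k % 8 = 7) with h | h | h | h <;>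
      simp [pow_two, Int.mul_emod, h]
  have heven : dRe x % 2 = 0 := by
    by_contra hne
    have := hodd (dRe x) (by omega)
    have := hodd (dI x) (by omega)
    have := hodd (dJ x) (by omega)
    have := hodd (dK x) (by omega)
    omega
  obtain ⟨a, ha⟩ : ∃ a, dRe x = 2 * a := ⟨dRe x / 2, by omega⟩
  obtain ⟨b, hb⟩ : ∃ a, dI x = 2 * a := ⟨dI x / 2, by omega⟩
  obtain ⟨c, hc⟩ : ∃ a, dJ x = 2 * a := ⟨dJ x / 2, by omega⟩
  obtain ⟨d, hd⟩ : ∃ a, dK x = 2 * a := ⟨dK x / 2, by omega⟩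
  rw [ha, hb, hc, hd] at hN m0 m1 m2 m3
  have hsq (k : ℤ) : k ^ 2 % 2 = k % 2 := by
    rcases Int.emod_two_eq_zero_or_one k with h | h <;> simp [pow_two, Int.mul_emod, h]
  have ea := hsq a
  have eb := hsq b
  have ec := hsq c
  have ed := hsq d
  ring_nf at hN
  -- These are the doubled coordinates of `x(1-i)/2`.
  obtain ⟨z, z0, z1, z2, z3⟩ := exists_of_coords (a + b) (b - a) (c - d) (c + d)
    (by omega) (by omega) (by omega)
  have hn := coords_intCast 2
  obtain ⟨n0, n1, n2, n3⟩ := hn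
  obtain ⟨k0, k1, k2, k3⟩ := coords_mul ((2 : ℤ) : hurwitzIntegers) z
  rw [n0, n1, n2, n3, z0, z1, z2, z3] at k0 k1 k2 k3
  refine ⟨z, ?_⟩
  rw [hθ, show ((2 : ℕ) : hurwitzIntegers) = ((2 : ℤ) : hurwitzIntegers) by norm_num]
  exact ext_coords (by linarith) (by linarith) (by linarith) (by linarith)

/-- `P = uθ` with `u` of norm one, so `P` and `θ` generate the same left ideal. -/
theorem exists_eq_mul_of_nrm_eq_two {x P : hurwitzIntegers} (hP : nrm P = 2) (hx : 2 ∣ nrm x) :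
    ∃ z, x = z * P := by
  obtain ⟨θ, hθ, h⟩ := exists_one_add_i
  obtain ⟨y, rfl⟩ := h x hx
  obtain ⟨u, rfl⟩ := h P (by rw [hP])
  rw [nrm_mul, hθ] at hP
  have hu : conj u * u = 1 := by rw [conj_mul, show nrm u = 1 by omega, Nat.cast_one]
  exact ⟨y * conj u, by rw [mul_assoc, ← mul_assoc (conj u), hu, one_mul]⟩

end Two

/-! ### Odd `p`: classes as points of the projective line -/

section Odd

variable {p : ℕ} [hp : Fact p.Prime] {s t : ZMod p} (h2 : (2 : ZMod p) ≠ 0)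
  (hst : s ^ 2 + t ^ 2 = -1)

theorem toMatrix_val_ne_zero (P : HurwitzPrime p) : toMatrix s t h2 hst P.val ≠ 0 := by
  rw [Ne, toMatrix_eq_zero_iff]
  rintro ⟨y, hy⟩
  have h := nrm_mul p y
  rw [← hy, nrm_val, nrm_natCast, pow_two, mul_assoc] at h
  have := Nat.eq_of_mul_eq_mul_left hp.out.pos ((mul_one p).trans h)
  exact hp.out.one_lt.ne' (Nat.eq_one_of_mul_eq_one_right this.symm)

theorem det_toMatrix_val (P : HurwitzPrime p) : (toMatrix s t h2 hst P.val).det = 0 := by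
  rw [det_toMatrix, nrm_val, CharP.cast_eq_zero]

/-- Divisibility means `x * conj P ≡ 0` modulo `p`; under reduction `conj P` becomes the adjugate,
whose columns span the kernel line of `P`. -/
theorem exists_eq_mul_val_iff (P : HurwitzPrime p) {v : Fin 2 → ZMod p} (hv0 : v ≠ 0)
    (hv : toMatrix s t h2 hst P.val *ᵥ v = 0) (x : hurwitzIntegers) :
    (∃ z, x = z * P.val) ↔ toMatrix s t h2 hst x *ᵥ v = 0 := by
  rw [exists_eq_mul_iff (val_ne_zero hp.out P), nrm_val, ← toMatrix_eq_zero_iff h2 hst, map_mul,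
    toMatrix_conj,
    mul_adjugate_eq_zero_iff_mulVec (toMatrix_val_ne_zero h2 hst P) (det_toMatrix_val h2 hst P)
      hv0 hv]

/-- Lift a nonzero singular matrix killing `w` to `a`, and let `d` generate the left ideal `ℋa +
ℋp`. Its norm divides `p²`. Norm `1` is excluded because `φ d = φ x * φ a` is singular, and norm
`p²` because `d` would then be a unit multiple of `p`, forcing `φ a = 0`. So `d` has norm `p`. -/
theorem exists_hurwitzPrime_mulVec_eq_zero (w : Fin 2 → ZMod p) (hw : w ≠ 0) :
    ∃ P : HurwitzPrime p, toMatrix s t h2 hst P.val *ᵥ w = 0 := by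
  set φ := toMatrix s t h2 hst
  have hφp : φ p = 0 := by
    rw [map_natCast, CharP.cast_eq_zero (Matrix (Fin 2) (Fin 2) (ZMod p)) p]
  obtain ⟨a, ha⟩ := toMatrix_surjective h2 hst !![w 1, -w 0; 0, 0]
  have haw : φ a *ᵥ w = 0 := by
    rw [show φ a = _ from ha]
    ext i
    fin_cases i
    · simp [vecHead, vecTail]
      ring
    · simp
  have ha0 : φ a ≠ 0 := by
    intro h
    apply hw
    rw [show φ a = _ from ha] at h
    have h0 : w 1 = 0 := congrFun (congrFun h 0) 0
    have h1 : -w 0 = 0 := congrFun (congrFun h 0) 1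
    ext i
    fin_cases i
    · exact neg_eq_zero.1 h1
    · exact h0
  have hadet : (φ a).det = 0 := by
    rw [show φ a = _ from ha, det_fin_two_of]
    ring
  obtain ⟨d, hd, hgen⟩ := exists_generator (Ideal.span {a, (p : hurwitzIntegers)})
  obtain ⟨b, hb⟩ := hgen a (Ideal.subset_span (by simp))
  obtain ⟨c, hc⟩ := hgen p (Ideal.subset_span (by simp))
  obtain ⟨x, y, hxy⟩ := Submodule.mem_span_pair.1 hd
  have hφd : φ d = φ x * φ a := by
    rw [← hxy, smul_eq_mul, smul_eq_mul, map_add, map_mul, map_mul, hφp, mul_zero, add_zero]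
  have hN : nrm c * nrm d = p ^ 2 := by rw [← nrm_mul, ← hc, nrm_natCast]
  obtain ⟨k, hk, hk'⟩ := (Nat.dvd_prime_pow hp.out).1 (Dvd.intro_left _ hN)
  have hd1 : nrm d ≠ 1 := by
    intro h
    have h' := det_toMatrix h2 hst d
    change (φ d).det = _ at h'
    rw [hφd, det_mul, hadet, mul_zero, h, Nat.cast_one] at h'
    exact zero_ne_one h'
  have hdp : nrm d ≠ p ^ 2 := by
    intro h
    rw [h] at hN
    have hc1 : nrm c = 1 :=
      Nat.eq_of_mul_eq_mul_right (pow_pos hp.out.pos 2) (hN.trans (one_mul _).symm)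
    apply ha0
    have : d = conj c * p := by rw [hc, ← mul_assoc, conj_mul, hc1, Nat.cast_one, one_mul]
    rw [hb, this, map_mul, map_mul, hφp, mul_zero, mul_zero]
  have hd : nrm d = p := by
    interval_cases k
    · exact absurd (by simpa using hk') hd1
    · simpa using hk'
    · exact absurd hk' hdp
  obtain ⟨P, hP⟩ := exists_hurwitzPrime_val_eq hp.out hd
  exact ⟨P, by rw [hP, hφd, ← mulVec_mulVec, haw, mulVec_zero]⟩

theorem exists_kernel_vector (P : HurwitzPrime p) :
    ∃ v : Fin 2 → ZMod p, v ≠ 0 ∧ toMatrix s t h2 hst P.val *ᵥ v = 0 :=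
  exists_mulVec_eq_zero_iff.2 (det_toMatrix_val h2 hst P)

/-- The kernel of the reduction of a Hurwitz prime of norm `p`, as a point of the projective
line. -/
noncomputable def kernelPoint (P : HurwitzPrime p) : Projectivization (ZMod p) (Fin 2 → ZMod p) :=
  Projectivization.mk _ _ (exists_kernel_vector h2 hst P).choose_spec.1

/-- The kernel is one-dimensional, so the chosen vector does not matter. -/
theorem kernelPoint_eq_mk_iff (P : HurwitzPrime p) {v : Fin 2 → ZMod p} (hv : v ≠ 0) :
    kernelPoint h2 hst P = Projectivization.mk _ v hv ↔ toMatrix s t h2 hst P.val *ᵥ v = 0 := by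
  obtain ⟨hw0, hw⟩ := (exists_kernel_vector h2 hst P).choose_spec
  rw [eq_comm, kernelPoint, Projectivization.mk_eq_mk_iff']
  constructor
  · rintro ⟨a, ha⟩
    rw [← ha, mulVec_smul, hw, smul_zero]
  · intro h
    obtain ⟨c, hc⟩ := exists_smul_eq_of_mulVec_eq_zero (toMatrix_val_ne_zero h2 hst P) hw0 hw h
    exact ⟨c, hc.symm⟩

theorem toClass_eq_iff_kernelPoint (P P' : HurwitzPrime p) :
    P.toClass = P'.toClass ↔ kernelPoint h2 hst P = kernelPoint h2 hst P' := by
  obtain ⟨v, hv0, hv⟩ := exists_kernel_vector h2 hst P'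
  rw [toClass_eq_iff hp.out, exists_eq_mul_val_iff h2 hst P' hv0 hv,
    (kernelPoint_eq_mk_iff h2 hst P' hv0).2 hv, kernelPoint_eq_mk_iff]

/-- `PQ ∈ ℋP'` means that `φ(P)φ(Q)` kills the line of `P'`. Note the direction: `g` takes the point
of `P'` to that of `P`. -/
theorem metacommutes_iff_kernelPoint {q : ℕ} (hq : q.Prime) (Q : HurwitzPrime q)
    (g : GL (Fin 2) (ZMod p)) (hg : g.val = toMatrix s t h2 hst Q.val) (P P' : HurwitzPrime p) :
    Metacommutes Q P P' ↔ kernelPoint h2 hst P = g • kernelPoint h2 hst P' := by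
  obtain ⟨v, hv0, hv⟩ := exists_kernel_vector h2 hst P'
  rw [metacommutes_iff hp.out hq, exists_eq_mul_val_iff h2 hst P' hv0 hv,
    (kernelPoint_eq_mk_iff h2 hst P' hv0).2 hv, Projectivization.smul_mk, kernelPoint_eq_mk_iff,
    Units.smul_def, smul_eq_mulVec, hg, mulVec_mulVec, map_mul]

/-- The classes of Hurwitz primes of norm `p` are the points of the projective line. -/
noncomputable def classEquiv :
    HurwitzPrimeClass p ≃ Projectivization (ZMod p) (Fin 2 → ZMod p) :=
  Equiv.ofBijective
    (Quotient.lift (kernelPoint h2 hst) fun P P' h =>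
      (toClass_eq_iff_kernelPoint h2 hst P P').1 (Quotient.sound h)) <| by
    constructor
    · intro x y
      induction x using Quotient.inductionOn with | h P =>
      induction y using Quotient.inductionOn with | h P' =>
      exact (toClass_eq_iff_kernelPoint h2 hst P P').2
    · intro y
      induction y using Projectivization.ind with | h w hw =>
      obtain ⟨P, hP⟩ := exists_hurwitzPrime_mulVec_eq_zero h2 hst w hw
      exact ⟨P.toClass, (kernelPoint_eq_mk_iff h2 hst P hw).2 hP⟩

/-- The reduction has kernel `pℋ`, and every scalar in `ZMod p` lifts to an integer. -/
theorem congruentToInt_iff (x : hurwitzIntegers) :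
    CongruentToInt p x ↔ ∃ c, toMatrix s t h2 hst x = scalar (Fin 2) c := by
  have key (n : ℤ) : (∃ y, x - (n : hurwitzIntegers) = (p : hurwitzIntegers) * y) ↔
      toMatrix s t h2 hst x = scalar (Fin 2) (n : ZMod p) := by
    rw [← toMatrix_eq_zero_iff h2 hst, map_sub, sub_eq_zero, toMatrix_intCast]
  constructor
  · rintro ⟨n, hn⟩
    exact ⟨n, (key n).1 hn⟩
  · rintro ⟨c, hc⟩
    exact ⟨c.val, (key _).2 (by simpa using hc)⟩

end Odd

end HurwitzInt

/-! ### Proof of the theorem -/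

open HurwitzInt

theorem theorem1 (p q : ℕ) [Fact p.Prime] [Fact q.Prime] (hpq : p ≠ q) (Q : HurwitzPrime q) :
    ∃ (_ : Fintype (HurwitzPrimeClass p)) (_ : DecidableEq (HurwitzPrimeClass p))
      (τ : Equiv.Perm (HurwitzPrimeClass p)),
      (p ≠ 2 → Fintype.card (HurwitzPrimeClass p) = p + 1) ∧
      (p = 2 → Fintype.card (HurwitzPrimeClass p) = 1) ∧
      (∀ P P' : HurwitzPrime p, τ P.toClass = P'.toClass ↔ Metacommutes Q P P') ∧
      ((Equiv.Perm.sign τ : ℤˣ) : ℤ) = legendreSym p (q : ℤ) ∧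
      ((p = 2 ∨ CongruentToInt p Q.val) → τ = 1) ∧
      (¬ (p = 2 ∨ CongruentToInt p Q.val) →
        (Nat.card (Function.fixedPoints τ) : ℤ) =
          1 + legendreSym p (hurwitzTrace Q.val ^ 2 - 4 * (q : ℤ))) := by
  classical
  have hp : p.Prime := Fact.out
  have hq : q.Prime := Fact.out
  by_cases hp2 : p = 2
  · subst hp2
    obtain ⟨θ, hθ, -⟩ := exists_one_add_i
    obtain ⟨P₀, -⟩ := exists_hurwitzPrime_val_eq hp hθ
    have hsub : ∀ x y : HurwitzPrimeClass 2, x = y := by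
      intro x y
      induction x using Quotient.inductionOn with | h P =>
      induction y using Quotient.inductionOn with | h P' =>
      exact (toClass_eq_iff hp P P').2
        (exists_eq_mul_of_nrm_eq_two (nrm_val P') (by rw [nrm_val]))
    let F : Fintype (HurwitzPrimeClass 2) := ⟨{P₀.toClass}, fun x => Finset.mem_singleton.2 (hsub x _)⟩
    refine ⟨F, inferInstance, 1, fun h => absurd rfl h, fun _ => ?_, fun P P' => ?_, ?_,
      fun _ => rfl, fun h => absurd (Or.inl rfl) h⟩
    · exact Fintype.card_eq_one_iff.2 ⟨P₀.toClass, fun y => hsub _ _⟩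
    · refine iff_of_true (hsub _ _) ((metacommutes_iff hp hq Q P P').2 ?_)
      exact exists_eq_mul_of_nrm_eq_two (nrm_val P') (by rw [nrm_mul, nrm_val]; exact ⟨_, rfl⟩)
    -- In characteristic two the quadratic character is `1` on nonzero elements, matching the
    -- identity permutation.
    · have hq2 : ((q : ℤ) : ZMod 2) ≠ 0 := by
        rw [Int.cast_natCast, Ne, ZMod.natCast_eq_zero_iff]
        exact fun h => hpq ((Nat.prime_dvd_prime_iff_eq hp hq).1 h)
      rw [map_one, legendreSym, quadraticChar_eq_one_of_char_two (ZMod.ringChar_zmod_n 2) hq2]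
      rfl
  · have hF : ringChar (ZMod p) ≠ 2 := by rwa [ZMod.ringChar_zmod_n]
    have h2 : (2 : ZMod p) ≠ 0 := Ring.two_ne_zero hF
    obtain ⟨s, t, hst⟩ := ZMod.sq_add_sq p (-1)
    have hqp : (q : ZMod p) ≠ 0 := by
      rw [Ne, ZMod.natCast_eq_zero_iff]
      exact fun h => hpq ((Nat.prime_dvd_prime_iff_eq hp hq).1 h)
    have hdet : (toMatrix s t h2 hst Q.val).det = q := by rw [det_toMatrix, nrm_val]
    let g : Matrix.GeneralLinearGroup (Fin 2) (ZMod p) :=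
      Matrix.GeneralLinearGroup.mkOfDetNeZero (toMatrix s t h2 hst Q.val) (by rwa [hdet])
    have hg : g.val = toMatrix s t h2 hst Q.val := rfl
    let E := (classEquiv h2 hst).trans (OnePoint.equivProjectivization (ZMod p)).symm
    let iOne : Fintype (OnePoint (ZMod p)) := inferInstanceAs (Fintype (Option (ZMod p)))
    let iClass : Fintype (HurwitzPrimeClass p) := Fintype.ofEquiv _ E.symm
    -- The inverse appears because `g` sends the point of `P'` back to that of `P`; it affects
    -- neither the sign nor the fixed points.
    let τ : Equiv.Perm (HurwitzPrimeClass p) := E.symm.permCongr (MulAction.toPerm g⁻¹)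
    have hτ (x : HurwitzPrimeClass p) : τ x = E.symm (g⁻¹ • E x) := rfl
    have hE (x y : HurwitzPrimeClass p) : τ x = y ↔
        classEquiv h2 hst x = g • classEquiv h2 hst y := by
      rw [hτ, Equiv.symm_apply_eq, inv_smul_eq_iff,
        ← (OnePoint.equivProjectivization (ZMod p)).apply_eq_iff_eq,
        OnePoint.equivProjectivization_smul]
      simp [E]
    refine ⟨iClass, inferInstance, τ, fun _ => ?_, fun h => absurd h hp2, fun P P' => ?_, ?_,
      ?_, ?_⟩
    · rw [← Nat.card_eq_fintype_card, Nat.card_congr (classEquiv h2 hst),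
        Projectivization.card_of_finrank_two _ _ (by simp), Nat.card_zmod]
    · rw [hE, metacommutes_iff_kernelPoint h2 hst hq Q g hg]
      rfl
    · have hinv : (MulAction.toPerm g⁻¹ : Equiv.Perm (OnePoint (ZMod p)))
          = (MulAction.toPerm g)⁻¹ := map_inv (MulAction.toPermHom _ _) g
      rw [Equiv.Perm.sign_permCongr, hinv, Equiv.Perm.sign_inv,
        sign_toPerm_generalLinearGroup hF, hg, hdet, legendreSym, Int.cast_natCast]
    · intro h
      obtain ⟨c, hc⟩ := (congruentToInt_iff h2 hst Q.val).1 (h.resolve_left hp2)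
      have hc0 : c ≠ 0 := by
        rintro rfl
        rw [hc, map_zero, Matrix.det_zero] at hdet
        exact hqp hdet.symm
      ext x
      rw [hE, Equiv.Perm.one_apply]
      induction classEquiv h2 hst x using Projectivization.ind with | h v hv =>
      rw [Projectivization.smul_mk, eq_comm, Projectivization.mk_eq_mk_iff']
      refine ⟨c, ?_⟩
      rw [Units.smul_def, Matrix.smul_eq_mulVec, hg, hc]
      simp [Matrix.scalar_apply, ← Matrix.smul_one_eq_diagonal, Matrix.smul_mulVec]
    · intro h
      have hns : ∀ c, g.val ≠ Matrix.scalar (Fin 2) c := fun c hc =>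
        h (Or.inr ((congruentToInt_iff h2 hst Q.val).2 ⟨c, hc⟩))
      have hfix : Function.fixedPoints τ = E ⁻¹' {x | g • x = x} := by
        ext x
        rw [Function.mem_fixedPoints, Function.IsFixedPt, hτ, Equiv.symm_apply_eq,
          inv_smul_eq_iff, eq_comm]
        rfl
      have hcard := ncard_fixedPoints_generalLinearGroup hF g hns
      rw [Nat.card_coe_set_eq, hfix,
        Set.ncard_preimage_of_injective_subset_range E.injective (by simp [E.surjective.range_eq]),
        hcard, hg, hdet, trace_toMatrix, legendreSym]
      push_cast
      -- `hurwitzTrace` and `dRe` have the same body.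
      rfl
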